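/- Let $\omega=\frac{1+\mathbf i\sqrt3}{2}$. A mixed graph $M_G$ is obtained from a finite simple graph $G$ by orienting some of its edges; it is connected if $G$ is. Its matrix $N=N(M_G)$ has entries $N_{uv}=\omega$ if $u\to v$ is an arc, $N_{uv}=\bar\omega$ if $v\to u$ is an arc, $N_{uv}=1$ if $\{u,v\}$ is an undirected edge, and $N_{uv}=0$ otherwise; the rank of $M_G$ is the rank of $N(M_G)$. Let $\mathbb T_6$ be the set of complex sixth roots of unity. A partition $V(M_G)=\bigcup_{j\in\mathbb T_6}V_j$ into (possibly empty) sets is admissible if each undirected edge joins two vertices of the same $V_j$, or a vertex of $V_j$ and a vertex of $V_{\omega j}$, for some $j\in\mathbb T_6$, and each arc goes from some $V_j$ to $V_j$, $V_{\bar\omega j}$ or $V_{-\omega j}$. The three-way switching for this partition replaces each undirected edge between $V_j$ and $V_{\omega j}$ by an arc from $V_j$ to $V_{\omega j}$, replaces each arc from $V_j$ to $V_{\bar\omega j}$ by an undirected edge, and reverses each arc from $V_j$ to $V_{-\omega j}$. Two mixed graphs are switching equivalent if one is obtained from the other (up to isomorphism, when their vertex sets differ) by a finite sequence of three-way switchings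 and of reversals of all arcs. Two vertices $u,v$ of $M_G$ are twins if $M_G$ is switching equivalent to a mixed graph $M'_G$ on the same vertices (no relabelling) with $N(M'_G)_{uj}=N(M'_G)_{vj}$ for all $j$. A twin reduction $T_{M_G}$ is the mixed graph induced on a set of vertices that is left after all but one vertex have been removed from every set of twins. Theorem. Let $M_G$ be a connected mixed graph, and let $T_{M_G}$ be any twin reduction of it. Then $M_G$ has rank $3$ if and only if $T_{M_G}$ is a mixed triangle (its underlying graph is $K_3$), or is switching equivalent to one of the following two mixed graphs with underlying graph $K_4$: (e) on vertices $0,1,2,3$, with arcs $1\to2$, $1\to3$, $2\to3$ and undirected edges $\{0,1\},\{0,2\},\{0,3\}$; (f) on vertices $0,1,2,3$, with arcs $0\to1$, $1\to2$, $2\to3$, $3\to0$ and undirected edges $\{0,2\},\{1,3\}$. -/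

import Mathlib

/-- A mixed graph on `V`: a simple graph (the underlying graph) together with an orientation of
some of its edges. `Arc u v` says that the edge `uv` is oriented from `u` to `v`; the edges which
are not oriented are the undirected edges. -/
structure MixedGraph (V : Type*) where
  /-- the underlying simple graph -/
  graph : SimpleGraph V
  /-- `Arc u v`: there is an arc from `u` to `v` -/
  Arc : V → V → Prop
  adj_of_arc : ∀ {u v : V}, Arc u v → graph.Adj u v
  arc_asymm : ∀ {u v : V}, Arc u v → ¬ Arc v u

namespace MixedGraph

/-- The primitive sixth root of unity `ω = (1 + i√3) / 2`. -/
noncomputable def omega : ℂ := (1 + Complex.I * (Real.sqrt 3 : ℂ)) / 2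

/-- Its complex conjugate `ω̄ = (1 - i√3) / 2`. -/
noncomputable def omegaBar : ℂ := (1 - Complex.I * (Real.sqrt 3 : ℂ)) / 2

variable {V : Type*} {W : Type*}

/-- `{u, v}` is an undirected (unoriented) edge. -/
def UEdge (M : MixedGraph V) (u v : V) : Prop :=
  M.graph.Adj u v ∧ ¬ M.Arc u v ∧ ¬ M.Arc v u

/-- A mixed graph is connected if its underlying graph is. -/
def Connected (M : MixedGraph V) : Prop := M.graph.Connected

open Classical in
/-- The Hermitian adjacency matrix of the second kind. -/
noncomputable def N (M : MixedGraph V) : Matrix V V ℂ := fun u v =>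
  if M.Arc u v then omega
  else if M.Arc v u then omegaBar
  else if M.graph.Adj u v then 1
  else 0

/-- The rank of a mixed graph is the rank of its Hermitian adjacency matrix of the second kind. -/
noncomputable def rank [Fintype V] (M : MixedGraph V) : ℕ := M.N.rank

/-- The converse: all arcs are reversed. -/
def converse (M : MixedGraph V) : MixedGraph V where
  graph := M.graph
  Arc u v := M.Arc v u
  adj_of_arc h := (M.adj_of_arc h).symm
  arc_asymm h := M.arc_asymm h

/-- A partition of `V` into six possibly empty sets `V_j`, indexed by the sixth roots of unity `j`,
is given by the function `f` that sends a vertex of `V_j` to `j`. It is admissible for `M` if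
each undirected edge is of type `(j, j)` or `(j, ω j)` (for one of its two orders of
the ends), and each arc is of type `(j, j)`, `(j, ω̄ j)` or `(j, -ω j)`. -/
structure IsAdmissible (M : MixedGraph V) (f : V → ℂ) : Prop where
  pow_six : ∀ v, f v ^ 6 = 1
  uedge : ∀ x y, M.UEdge x y → f y = f x ∨ f y = omega * f x ∨ f x = omega * f y
  arc : ∀ x y, M.Arc x y → f y = f x ∨ f y = omegaBar * f x ∨ f y = -omega * f x

/-- `M'` results from `M` by the three-way switching with respect to some admissible partition:
the undirected edges of type `(j, ω j)` become arcs from `V_j` to `V_{ω j}`, the arcs of type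
`(j, ω̄ j)` become undirected edges, the arcs of type `(j, -ω j)` are reversed, and nothing else
changes. -/
def IsThreeWaySwitching (M M' : MixedGraph V) : Prop :=
  ∃ f : V → ℂ, M.IsAdmissible f ∧ M'.graph = M.graph ∧
    ∀ x y, M'.Arc x y ↔
      (M.Arc x y ∧ f y = f x) ∨ (M.UEdge x y ∧ f y = omega * f x) ∨
        (M.Arc y x ∧ f x = -omega * f y)

/-- Switching equivalence of two mixed graphs on the same vertices: the second is obtained from the
first by a finite sequence of three-way switchings and operations of taking the converse. -/
def SwitchingEquivalent : MixedGraph V → MixedGraph V → Prop :=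
  Relation.ReflTransGen fun M M' => M.IsThreeWaySwitching M' ∨ M' = M.converse

/-- Isomorphism of mixed graphs. -/
def Isomorphic (M : MixedGraph V) (M' : MixedGraph W) : Prop :=
  ∃ e : V ≃ W, (∀ u v, M'.graph.Adj (e u) (e v) ↔ M.graph.Adj u v) ∧
    ∀ u v, M'.Arc (e u) (e v) ↔ M.Arc u v

/-- `M` is switching equivalent to (a copy on its own vertices of) the mixed graph `F`. -/
def SwitchingEquivalentTo (M : MixedGraph V) (F : MixedGraph W) : Prop :=
  ∃ M' : MixedGraph V, M.SwitchingEquivalent M' ∧ M'.Isomorphic F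

/-- Two vertices are twins if some mixed graph that is switching equivalent to `M` has equal rows
at these vertices. -/
def Twins (M : MixedGraph V) (u v : V) : Prop :=
  ∃ M' : MixedGraph V, M.SwitchingEquivalent M' ∧ ∀ j, M'.N u j = M'.N v j

/-- The mixed subgraph induced on the set `S` of vertices. -/
def induce (M : MixedGraph V) (S : Set V) : MixedGraph S where
  graph := M.graph.induce S
  Arc u v := M.Arc u v
  adj_of_arc h := M.adj_of_arc h
  arc_asymm h := M.arc_asymm h

/-- `S` is left over when all but one vertex is removed from every set of twins: each vertex has a
twin in `S` (possibly itself), and no two different vertices of `S` are twins. -/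
def IsTwinTransversal (M : MixedGraph V) (S : Set V) : Prop :=
  (∀ v, ∃ s ∈ S, M.Twins v s) ∧ ∀ s ∈ S, ∀ t ∈ S, M.Twins s t → s = t

/-- Sanity check: twin transversals exist. -/
theorem exists_isTwinTransversal [Finite V] (M : MixedGraph V) :
    ∃ S, M.IsTwinTransversal S := by
  obtain ⟨S, hS⟩ := Set.Finite.exists_maximal
    (Set.toFinite {S : Set V | ∀ s ∈ S, ∀ t ∈ S, M.Twins s t → s = t})
    ⟨∅, fun s hs => absurd hs (Set.notMem_empty s)⟩
  have hsymm : ∀ {u v}, M.Twins u v → M.Twins v u :=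
    fun ⟨M', h, h'⟩ => ⟨M', h, fun j => (h' j).symm⟩
  refine ⟨S, fun v => ?_, hS.prop⟩
  by_contra! hv
  have hmem : v ∈ S := by
    refine hS.le_of_ge (y := insert v S) ?_ (Set.subset_insert v S) (Set.mem_insert v S)
    rintro s (rfl | hs) t (rfl | ht) hst
    · rfl
    · exact absurd hst (hv t ht)
    · exact absurd (hsymm hst) (hv s hs)
    · exact hS.prop s hs t ht hst
  exact hv v hmem ⟨M, Relation.ReflTransGen.refl, fun _ => rfl⟩

/-- A mixed triangle: the underlying graph is a triangle. -/
def IsMixedTriangle (M : MixedGraph V) : Prop :=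
  Nonempty (M.graph ≃g (⊤ : SimpleGraph (Fin 3)))

/-- The mixed `K₄` with arcs `1 → 2`, `1 → 3`, `2 → 3` and undirected edges `{0,1}`, `{0,2}`,
`{0,3}`. All its triangles are semi-positive. -/
def mixedK4e : MixedGraph (Fin 4) where
  graph := ⊤
  Arc u v := (u, v) = (1, 2) ∨ (u, v) = (1, 3) ∨ (u, v) = (2, 3)
  adj_of_arc := by simp only [SimpleGraph.top_adj]; decide
  arc_asymm := by decide

/-- The mixed `K₄` with the directed cycle `0 → 1 → 2 → 3 → 0` and undirected edges `{0,2}`,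
`{1,3}`. All its triangles are semi-negative. -/
def mixedK4f : MixedGraph (Fin 4) where
  graph := ⊤
  Arc u v := (u, v) = (0, 1) ∨ (u, v) = (1, 2) ∨ (u, v) = (2, 3) ∨ (u, v) = (3, 0)
  adj_of_arc := by simp only [SimpleGraph.top_adj]; decide
  arc_asymm := by decide

end MixedGraph

/-! A three-way switching conjugates `N` by a diagonal matrix of sixth roots of unity, and taking
the converse transposes it, so switching equivalence preserves the rank. Twins are exactly pairs of
vertices whose rows are proportional with a sixth root of unity as factor (`Twins.exists_N_eq`,
`twins_of_N_eq`). Hence a twin reduction has the rank of the whole graph, and no two of its rows are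
proportional in this way.

It remains to classify the reduced matrices of rank 3 (`IsSixthGain.classification`). A Hermitian
matrix of rank 3 has a nonzero principal minor of order 3. Such a minor is twice the real part of
the gain of a triangle, which is never 0 for a sixth root of unity, so nonzero minors of order 3 and
triangles are the same thing, and every row is determined by its entries at a triangle. All
principal minors of order 4 vanish. For a triangle and a vertex missing one of its corners, this
makes the vertex isolated or a twin of that corner; so the reduced graph is complete. On four
vertices the equation is a condition on the exponents of the triangle gains, whose solutions, after
reordering the vertices, have all gains `ω` or all gains `ω²`. On five vertices the equations force
two adjacent vertices to have proportional rows, which is impossible. Finally, a complete graph is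
determined up to diagonal conjugation by the gains of its triangles at one vertex, which identifies
the two cases on four vertices with `mixedK4e` and `mixedK4f`.

Conversely, a triangle bounds the rank below by 3, and both exceptional matrices of order 4 are
singular. -/

namespace MixedGraph

/-! ### Sixth roots of unity -/

theorem omega_sq : omega ^ 2 = omega - 1 := by
  have h3 : ((Real.sqrt 3 : ℝ) : ℂ) ^ 2 = 3 := by
    rw [← Complex.ofReal_pow, Real.sq_sqrt (by norm_num)]; norm_num
  unfold omega
  linear_combination (1 / 4) * Complex.I ^ 2 * h3 + (3 / 4) * Complex.I_sq

theorem omegaBar_eq : omegaBar = 1 - omega := by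
  unfold omega omegaBar; ring

theorem star_omega : star omega = omegaBar := by
  simp [omega, omegaBar, Complex.conj_ofReal, sub_eq_add_neg]

theorem star_omegaBar : star omegaBar = omega := by
  rw [← star_omega, star_star]

theorem omega_mul_omegaBar : omega * omegaBar = 1 := by
  rw [omegaBar_eq]; linear_combination -omega_sq

theorem omega_pow_three : omega ^ 3 = -1 := by
  linear_combination (omega + 1) * omega_sq

theorem omega_pow_six : omega ^ 6 = 1 := by
  linear_combination (omega ^ 3 - 1) * omega_pow_three

theorem omega_ne_zero : omega ≠ 0 := by
  intro h; simpa [h] using omega_pow_six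

theorem omegaBar_ne_zero : omegaBar ≠ 0 := by
  intro h; simpa [h] using omega_mul_omegaBar

theorem omega_ne_one : omega ≠ 1 := by
  intro h; simpa [h] using omega_sq

theorem omegaBar_ne_one : omegaBar ≠ 1 := by
  rw [omegaBar_eq]; simpa using omega_ne_zero

theorem omega_ne_omegaBar : omega ≠ omegaBar := by
  rw [omegaBar_eq]
  intro h
  have h1 : omega = 1 / 2 := by linear_combination h / 2
  have := omega_sq
  rw [h1] at this
  norm_num at this

/-- The sixth root of unity with exponent `k`. -/
noncomputable def sixthRoot (k : ZMod 6) : ℂ := omega ^ k.val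

theorem sixthRoot_zero : sixthRoot 0 = 1 := by simp [sixthRoot]

theorem sixthRoot_one : sixthRoot 1 = omega := by
  have : (1 : ZMod 6).val = 1 := rfl
  simp [sixthRoot, this]

theorem sixthRoot_add (k l : ZMod 6) : sixthRoot (k + l) = sixthRoot k * sixthRoot l := by
  rw [sixthRoot, ZMod.val_add, ← pow_eq_pow_mod _ omega_pow_six, pow_add]; rfl

theorem sixthRoot_mul_neg (k : ZMod 6) : sixthRoot k * sixthRoot (-k) = 1 := by
  rw [← sixthRoot_add, add_neg_cancel, sixthRoot_zero]

theorem sixthRoot_neg (k : ZMod 6) : sixthRoot (-k) = (sixthRoot k)⁻¹ :=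
  (inv_eq_of_mul_eq_one_right (sixthRoot_mul_neg k)).symm

theorem sixthRoot_pow_six (k : ZMod 6) : sixthRoot k ^ 6 = 1 := by
  rw [sixthRoot, ← pow_mul, mul_comm, pow_mul, omega_pow_six, one_pow]

theorem sixthRoot_neg_one : sixthRoot (-1) = omegaBar := by
  rw [sixthRoot_neg, sixthRoot_one]
  exact inv_eq_of_mul_eq_one_right omega_mul_omegaBar

theorem exists_sixthRoot_eq {z : ℂ} (hz : z ^ 6 = 1) : ∃ k, z = sixthRoot k := by
  have h4 : omega ^ 4 = -omega := by linear_combination omega * omega_pow_three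
  have h5 : omega ^ 5 = 1 - omega := by
    linear_combination omega ^ 2 * omega_pow_three - omega_sq
  have h1 : (z - omega) * (z - omega ^ 5) = z ^ 2 - z + 1 := by
    rw [h5]; linear_combination -omega_sq
  have h2 : (z - omega ^ 2) * (z - omega ^ 4) = z ^ 2 + z + 1 := by
    rw [h4, omega_sq]; linear_combination -omega_sq
  -- This is `z ^ 6 - 1 = (z² - 1)(z² - z + 1)(z² + z + 1)`. The roots are kept as powers of `omega`
  -- so that each case matches `sixthRoot` by definition.
  have h : (z - omega ^ 0) * (z - omega ^ 3) * ((z - omega) * (z - omega ^ 5)) *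
      ((z - omega ^ 2) * (z - omega ^ 4)) = 0 := by
    rw [h1, h2, omega_pow_three]
    linear_combination hz
  simp only [mul_eq_zero, sub_eq_zero] at h
  rcases h with ((h | h) | (h | h)) | (h | h)
  · exact ⟨0, h⟩
  · exact ⟨3, h⟩
  · exact ⟨1, h.trans (pow_one _).symm⟩
  · exact ⟨5, h⟩
  · exact ⟨2, h⟩
  · exact ⟨4, h⟩

theorem star_sixthRoot (k : ZMod 6) : star (sixthRoot k) = sixthRoot (-k) := by
  rw [sixthRoot, star_pow, star_omega, sixthRoot_neg, sixthRoot, ← inv_pow,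
    inv_eq_of_mul_eq_one_right omega_mul_omegaBar]

theorem inv_eq_star_of_pow_six {z : ℂ} (hz : z ^ 6 = 1) : z⁻¹ = star z := by
  obtain ⟨k, rfl⟩ := exists_sixthRoot_eq hz
  rw [star_sixthRoot, sixthRoot_neg]

/-- Twice the real part of the sixth root of unity with a given exponent. -/
def twoRe : ZMod 6 → ℤ := ![2, 1, -1, -2, -1, 1]

theorem sixthRoot_add_sixthRoot_neg (k : ZMod 6) :
    sixthRoot k + sixthRoot (-k) = twoRe k := by
  have h4 : omega ^ 4 = -omega := by linear_combination omega * omega_pow_three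
  have h5 : omega ^ 5 = 1 - omega := by
    linear_combination omega ^ 2 * omega_pow_three - omega_sq
  have aux : ∀ k : ZMod 6, ∃ n < 6, k.val = n ∧ (-k).val = (6 - n) % 6 ∧
    twoRe k = [2, 1, -1, -2, -1, 1].getD n 0 := by decide
  obtain ⟨n, hn, h1, h2, h3⟩ := aux k
  rw [sixthRoot, sixthRoot, h1, h2, h3]
  interval_cases n <;> norm_num [h4, h5, omega_sq, omega_pow_three] <;> ring

/-! ### The matrix -/

variable {V : Type*} {W : Type*}

theorem N_eq_omega (M : MixedGraph V) {u v : V} : M.N u v = omega ↔ M.Arc u v := by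
  unfold N
  split_ifs <;> simp_all [omega_ne_omegaBar.symm, omega_ne_one.symm, omega_ne_zero.symm]

theorem N_eq_omegaBar (M : MixedGraph V) {u v : V} : M.N u v = omegaBar ↔ M.Arc v u := by
  have := M.arc_asymm (u := u) (v := v)
  unfold N
  split_ifs <;> simp_all [omega_ne_omegaBar, omegaBar_ne_one.symm, omegaBar_ne_zero.symm]

theorem N_eq_one (M : MixedGraph V) {u v : V} : M.N u v = 1 ↔ M.UEdge u v := by
  unfold N UEdge
  split_ifs <;> simp_all [omega_ne_one, omegaBar_ne_one]

theorem N_eq_zero (M : MixedGraph V) {u v : V} : M.N u v = 0 ↔ ¬ M.graph.Adj u v := by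
  have h1 := M.adj_of_arc (u := u) (v := v)
  have h2 := M.adj_of_arc (u := v) (v := u)
  rw [M.graph.adj_comm] at h2
  unfold N
  split_ifs <;> simp_all [omega_ne_zero, omegaBar_ne_zero]

theorem N_self (M : MixedGraph V) (u : V) : M.N u u = 0 := by simp [N_eq_zero]

theorem star_N (M : MixedGraph V) (u v : V) : star (M.N u v) = M.N v u := by
  have h1 := M.arc_asymm (u := u) (v := v)
  have h2 := M.graph.adj_comm u v
  unfold N
  split_ifs <;> simp_all [-Complex.star_def, star_omega, star_omegaBar]

theorem N_mem (M : MixedGraph V) (u v : V) :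
    M.N u v = 0 ∨ M.N u v = 1 ∨ M.N u v = omega ∨ M.N u v = omegaBar := by
  unfold N
  split_ifs <;> simp

theorem N_pow_six (M : MixedGraph V) (u v : V) : M.N u v = 0 ∨ M.N u v ^ 6 = 1 := by
  rcases M.N_mem u v with h | h | h | h <;> rw [h]
  · exact Or.inl rfl
  · exact Or.inr (one_pow 6)
  · exact Or.inr omega_pow_six
  · rw [← sixthRoot_neg_one]
    exact Or.inr (sixthRoot_pow_six _)

theorem N_converse (M : MixedGraph V) (u v : V) : M.converse.N u v = M.N v u := by
  have h2 := M.graph.adj_comm u v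
  unfold N converse
  split_ifs <;> simp_all

/-- A Hermitian matrix with zero diagonal and entries `0, 1, ω, ω̄` belongs to a mixed graph. -/
theorem exists_N_eq (H : V → V → ℂ) (h0 : ∀ u, H u u = 0) (hstar : ∀ u v, star (H u v) = H v u)
    (hmem : ∀ u v, H u v = 0 ∨ H u v = 1 ∨ H u v = omega ∨ H u v = omegaBar) :
    ∃ M : MixedGraph V, ∀ u v, M.N u v = H u v := by
  refine ⟨⟨⟨fun u v => H u v ≠ 0, ⟨fun u v h => ?_⟩, ⟨fun u h => h (h0 u)⟩⟩,
    fun u v => H u v = omega, fun {u v} h => ?_, fun {u v} h h' => ?_⟩, fun u v => ?_⟩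
  · rw [← hstar]
    exact star_ne_zero.mpr h
  · change H u v ≠ 0
    rw [h]; exact omega_ne_zero
  · rw [← hstar, h, star_omega] at h'
    exact omega_ne_omegaBar h'.symm
  · have hvu : H v u = star (H u v) := (hstar u v).symm
    rcases hmem u v with h | h | h | h <;> simp only [N, hvu, h]
    · simp [omega_ne_zero.symm]
    · simp [omega_ne_one.symm]
    · simp
    · simp [-Complex.star_def, star_omegaBar, omega_ne_omegaBar.symm]

/-! ### Switching as diagonal similarity -/

theorem IsThreeWaySwitching.exists_N_eq {M M' : MixedGraph V} (h : M.IsThreeWaySwitching M') :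
    ∃ f : V → ℂ, (∀ v, f v ^ 6 = 1) ∧ ∀ u v, M'.N u v = (f u)⁻¹ * M.N u v * f v := by
  obtain ⟨f, hf, hG, hA⟩ := h
  have hf0 : ∀ v, f v ≠ 0 := fun v h => by simpa [h] using hf.pow_six v
  have hone := omega_mul_omegaBar
  have key : ∀ u v, M.Arc u v → M'.N u v = (f u)⁻¹ * M.N u v * f v := by
    intro u v huv
    have hvu := M.arc_asymm huv
    have hU : ¬ M.UEdge u v := fun h => h.2.1 huv
    have hU' : ¬ M.UEdge v u := fun h => h.2.2 huv
    have hu := hf0 u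
    rw [M.N_eq_omega.mpr huv]
    rcases hf.arc u v huv with h | h | h
    · rw [M'.N_eq_omega.mpr ((hA u v).mpr (Or.inl ⟨huv, h⟩)), h]
      field_simp
    · have h1 : M'.N u v = 1 := by
        refine M'.N_eq_one.mpr ⟨hG ▸ M.adj_of_arc huv, ?_, ?_⟩
        · rw [hA]
          rintro (⟨-, h'⟩ | ⟨h', -⟩ | ⟨h', -⟩)
          · rw [h] at h'
            exact omegaBar_ne_one (mul_right_cancel₀ hu (by rw [h', one_mul]))
          · exact hU h'
          · exact hvu h'
        · rw [hA]
          rintro (⟨h', -⟩ | ⟨h', -⟩ | ⟨-, h'⟩)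
          · exact hvu h'
          · exact hU' h'
          · rw [h] at h'
            have := mul_right_cancel₀ hu h'
            rw [omegaBar_eq] at this
            exact one_ne_zero (α := ℂ) (by linear_combination this)
      rw [h1, h]
      field_simp
      exact hone.symm
    · rw [M'.N_eq_omegaBar.mpr ((hA v u).mpr (Or.inr (Or.inr ⟨huv, h⟩))), h, omegaBar_eq]
      field_simp
      linear_combination omega_sq
  refine ⟨f, hf.pow_six, fun u v => ?_⟩
  by_cases huv : M.Arc u v
  · exact key u v huv
  by_cases hvu : M.Arc v u
  · have := congrArg star (key v u hvu)
    rw [star_N, star_mul, star_mul, star_N, ← inv_eq_star_of_pow_six (hf.pow_six u),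
      inv_eq_star_of_pow_six (hf.pow_six v), star_star] at this
    rw [this]; ring
  by_cases hadj : M.graph.Adj u v
  swap
  · rw [M.N_eq_zero.mpr hadj, M'.N_eq_zero.mpr (hG ▸ hadj)]; simp
  have hU : M.UEdge u v := ⟨hadj, huv, hvu⟩
  have hU' : M.UEdge v u := ⟨hadj.symm, hvu, huv⟩
  rw [M.N_eq_one.mpr hU]
  have hu := hf0 u
  have hv := hf0 v
  rcases hf.uedge u v hU with h | h | h
  · have h1 : M'.N u v = 1 := by
      refine M'.N_eq_one.mpr ⟨hG ▸ hadj, ?_, ?_⟩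
      · rw [hA]
        rintro (⟨h', -⟩ | ⟨-, h'⟩ | ⟨h', -⟩)
        · exact huv h'
        · rw [h] at h'
          exact omega_ne_one (mul_right_cancel₀ hu (by rw [← h', one_mul]))
        · exact hvu h'
      · rw [hA]
        rintro (⟨h', -⟩ | ⟨-, h'⟩ | ⟨h', -⟩)
        · exact hvu h'
        · rw [h] at h'
          exact omega_ne_one (mul_right_cancel₀ hu (by rw [← h', one_mul]))
        · exact huv h'
    rw [h1, h]
    field_simp
  · rw [M'.N_eq_omega.mpr ((hA u v).mpr (Or.inr (Or.inl ⟨hU, h⟩))), h]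
    field_simp
  · rw [M'.N_eq_omegaBar.mpr ((hA v u).mpr (Or.inr (Or.inl ⟨hU', h⟩))), h]
    have := omega_ne_zero
    field_simp
    exact (mul_comm _ _).trans hone

/-- Admissibility of `f` says precisely that the conjugated entries stay among `0, 1, ω, ω̄`, so it
is automatic once the conjugate is the matrix of a mixed graph. -/
theorem isThreeWaySwitching_of_N_eq {M M' : MixedGraph V} {f : V → ℂ} (hf : ∀ v, f v ^ 6 = 1)
    (h : ∀ u v, M'.N u v = (f u)⁻¹ * M.N u v * f v) : M.IsThreeWaySwitching M' := by
  have hf0 : ∀ v, f v ≠ 0 := fun v h => by simpa [h] using hf v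
  have hone := omega_mul_omegaBar
  have h' : ∀ u v, M.N u v * f v = M'.N u v * f u := fun u v => by
    rw [h]; have := hf0 u; field_simp
  have hG : M'.graph = M.graph := by
    ext u v; rw [← not_iff_not, ← N_eq_zero, ← N_eq_zero, h]; simp [hf0]
  have hsq : omegaBar * omegaBar = -omega := by
    rw [omegaBar_eq]; linear_combination omega_sq
  have hadm : M.IsAdmissible f := by
    refine ⟨hf, fun x y hxy => ?_, fun x y hxy => ?_⟩
    · have e := h' x y
      rw [M.N_eq_one.mpr hxy, one_mul] at e
      rcases M'.N_mem x y with h1 | h1 | h1 | h1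
      · rw [h1, zero_mul] at e
        exact absurd e (hf0 y)
      · rw [h1, one_mul] at e
        exact Or.inl e
      · rw [h1] at e
        exact Or.inr (Or.inl e)
      · rw [h1] at e
        refine Or.inr (Or.inr ?_)
        rw [e]
        linear_combination -f x * hone
    · have e := h' x y
      rw [M.N_eq_omega.mpr hxy] at e
      have e' : f y = omegaBar * M'.N x y * f x := by
        linear_combination omegaBar * e - f y * hone
      rcases M'.N_mem x y with h1 | h1 | h1 | h1
      · rw [h1] at e'
        exact absurd (by simpa using e') (hf0 y)
      · exact Or.inr (Or.inl (by rw [e', h1, mul_one]))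
      · rw [h1] at e'
        exact Or.inl (by linear_combination e' + f x * hone)
      · exact Or.inr (Or.inr (by rw [e', h1, hsq]))
  refine ⟨f, hadm, hG, fun x y => ⟨fun hxy => ?_, ?_⟩⟩
  · have e := h' x y
    rw [M'.N_eq_omega.mpr hxy] at e
    rcases M.N_mem x y with h1 | h1 | h1 | h1
    · exact absurd (hG ▸ M'.adj_of_arc hxy) (M.N_eq_zero.mp h1)
    · rw [h1, one_mul] at e
      exact Or.inr (Or.inl ⟨M.N_eq_one.mp h1, e⟩)
    · rw [h1] at e
      exact Or.inl ⟨M.N_eq_omega.mp h1, mul_left_cancel₀ omega_ne_zero e⟩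
    · refine Or.inr (Or.inr ⟨M.N_eq_omegaBar.mp h1, ?_⟩)
      rw [h1] at e
      linear_combination omegaBar * (-e) - f x * hone + f y * hsq
  · rintro (⟨hA, e⟩ | ⟨hU, e⟩ | ⟨hA, e⟩)
    · rw [← N_eq_omega, h, M.N_eq_omega.mpr hA, e]
      have := hf0 x
      field_simp
    · rw [← N_eq_omega, h, M.N_eq_one.mpr hU, e]
      have := hf0 x
      field_simp
    · rw [← N_eq_omega, h, M.N_eq_omegaBar.mpr hA, e, omegaBar_eq]
      have := hf0 y
      have := omega_ne_zero
      field_simp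
      linear_combination -omega_sq

theorem SwitchingEquivalent.exists_N_eq {M M' : MixedGraph V} (h : M.SwitchingEquivalent M') :
    ∃ f : V → ℂ, (∀ v, f v ^ 6 = 1) ∧ ((∀ u v, M'.N u v = (f u)⁻¹ * M.N u v * f v) ∨
      ∀ u v, M'.N u v = (f u)⁻¹ * M.N v u * f v) := by
  induction h with
  | refl => exact ⟨fun _ => 1, by simp, by simp⟩
  | tail _ hstep ih =>
    obtain ⟨f, hf, ih⟩ := ih
    have hf0 : ∀ v, f v ≠ 0 := fun v h => by simpa [h] using hf v
    rcases hstep with hstep | rfl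
    · obtain ⟨g, hg, hstep⟩ := hstep.exists_N_eq
      refine ⟨fun v => f v * g v, fun v => by rw [mul_pow, hf, hg, one_mul], ?_⟩
      refine ih.imp (fun ih u v => ?_) (fun ih u v => ?_) <;>
      · rw [hstep, ih, mul_inv]; ring
    -- Transposition inverts the conjugating diagonal and exchanges the two alternatives.
    · refine ⟨fun v => (f v)⁻¹, fun v => by rw [inv_pow, hf, inv_one], ih.symm.imp ?_ ?_⟩ <;>
      · intro ih u v
        rw [N_converse, ih, inv_inv]; ring

theorem Twins.exists_N_eq {M : MixedGraph V} {u v : V} (h : M.Twins u v) :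
    ∃ c : ℂ, c ^ 6 = 1 ∧ ∀ j, M.N u j = c * M.N v j := by
  obtain ⟨M', h, huv⟩ := h
  obtain ⟨f, hf, h⟩ := h.exists_N_eq
  have hf0 : ∀ v, f v ≠ 0 := fun v h => by simpa [h] using hf v
  have hu := hf0 u
  have hv := hf0 v
  rcases h with h | h
  · refine ⟨f u / f v, by rw [div_pow, hf, hf, div_one], fun j => ?_⟩
    have := huv j
    rw [h, h] at this
    have hj := hf0 j
    field_simp at this ⊢
    linear_combination this
  -- Here the relation is between the columns of `u` and `v`; since `N` is Hermitian, conjugating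
  -- turns it into one between rows.
  · refine ⟨star (f u / f v), by rw [← star_pow, div_pow, hf, hf, div_one, star_one], fun j => ?_⟩
    have := huv j
    rw [h, h] at this
    rw [← star_N, ← M.star_N j v, ← star_mul']
    congr 1
    have hj := hf0 j
    field_simp at this ⊢
    linear_combination this

theorem twins_of_N_eq {M : MixedGraph V} {u v : V} {c : ℂ} (hc : c ^ 6 = 1)
    (h : ∀ j, M.N u j = c * M.N v j) : M.Twins u v := by
  classical
  have hc0 : c ≠ 0 := fun h => by simp [h] at hc
  have hcs := inv_eq_star_of_pow_six hc
  have huv : M.N u v = 0 := by rw [h, N_self, mul_zero]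
  have hvu : M.N v u = 0 := by rw [← star_N, huv, star_zero]
  -- Rescaling at `u` alone turns row `u` into row `v`. The entries therefore remain admissible, and
  -- a single switching suffices.
  let f : V → ℂ := fun x => if x = u then c else 1
  have hf : ∀ x, f x ^ 6 = 1 := fun x => by
    by_cases hx : x = u <;> simp [f, hx, hc]
  let H : V → V → ℂ := fun x y => (f x)⁻¹ * M.N x y * f y
  have hrow : ∀ j, H u j = M.N v j := fun j => by
    by_cases hj : j = u
    · simp [H, f, hj, N_self, hvu]
    · simp only [H, f, hj, if_true, if_false, h j]
      field_simp
  have hstar : ∀ x y, star (H x y) = H y x := fun x y => by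
    simp only [H]
    rw [star_mul, star_mul, star_N, ← inv_eq_star_of_pow_six (hf y),
      inv_eq_star_of_pow_six (hf x), star_star]
    ring
  obtain ⟨M', hM'⟩ := MixedGraph.exists_N_eq H (fun x => by simp [H, N_self]) hstar (fun x y => by
    by_cases hx : x = u
    · rw [hx, hrow]; exact M.N_mem _ _
    · by_cases hy : y = u
      · rw [← hstar, hy, hrow, star_N]; exact M.N_mem _ _
      · have : H x y = M.N x y := by simp [H, f, hx, hy]
        rw [this]; exact M.N_mem _ _)
  refine ⟨M', Relation.ReflTransGen.single
    (Or.inl (isThreeWaySwitching_of_N_eq hf hM')), fun j => ?_⟩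
  rw [hM', hM', hrow]
  by_cases hv : v = u
  · rw [hv, hrow, hv]
  · by_cases hj : j = u
    · simp [H, hj, hvu]
    · simp [H, f, hv, hj]

end MixedGraph

/-! ### Maximal nonsingular submatrices and principal minors -/

namespace Matrix

variable {m n κ K : Type*} [Field K] [Fintype κ] [DecidableEq κ]

/-- If a maximal nonsingular submatrix is given, then a vector of the row space which vanishes on
its columns is zero. -/
theorem eq_zero_of_mem_span_row [Fintype n] [Finite m] {H : Matrix m n K} {s : κ → m} {t : κ → n}
    (hdet : (H.submatrix s t).det ≠ 0) (hrank : H.rank = Fintype.card κ) {y : n → K}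
    (hy : y ∈ Submodule.span K (Set.range H.row)) (hyt : ∀ i, y (t i) = 0) : y = 0 := by
  have key : ∀ l : κ → K, (∀ j, ∑ i, l i * H (s i) (t j) = 0) → l = 0 := fun l hl => by
    by_contra hne
    exact hdet (exists_vecMul_eq_zero_iff.mp ⟨l, hne, funext hl⟩)
  have hli : LinearIndependent K fun i => H.row (s i) := by
    rw [Fintype.linearIndependent_iff]
    intro l hl
    refine congrFun (key l fun j => ?_)
    simpa [Finset.sum_apply] using congrFun hl (t j)
  have hspan : Submodule.span K (Set.range fun i => H.row (s i)) =
      Submodule.span K (Set.range H.row) := by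
    refine Submodule.eq_of_le_of_finrank_eq
      (Submodule.span_mono (Set.range_comp_subset_range s H.row)) ?_
    rw [finrank_span_eq_card hli, ← hrank, rank_eq_finrank_span_row]
  rw [← hspan, Submodule.mem_span_range_iff_exists_fun] at hy
  obtain ⟨l, rfl⟩ := hy
  have : l = 0 := key l fun j => by simpa [Finset.sum_apply] using hyt j
  simp [this]

theorem row_eq_of_eq_on [Fintype n] [Finite m] {H : Matrix m n K} {s : κ → m} {t : κ → n}
    (hdet : (H.submatrix s t).det ≠ 0) (hrank : H.rank = Fintype.card κ) {u v : m} {k : K}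
    (h : ∀ i, H u (t i) = k * H v (t i)) (j : n) : H u j = k * H v j := by
  have := eq_zero_of_mem_span_row hdet hrank (y := H.row u - k • H.row v)
    (sub_mem (Submodule.subset_span ⟨u, rfl⟩)
      (Submodule.smul_mem _ _ (Submodule.subset_span ⟨v, rfl⟩))) (fun i => by simp [h])
  simpa [sub_eq_zero] using congrFun this j

/-- A Hermitian matrix of rank `r` has a nonzero principal minor of order `r`. -/
theorem exists_principal_minor_ne_zero [Fintype n] {H : Matrix n n ℂ} (hH : H.IsHermitian) {r : ℕ}
    (hr : H.rank = r) : ∃ s : Fin r → n, (H.submatrix s s).det ≠ 0 := by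
  have h := Submodule.exists_fun_fin_finrank_span_eq ℂ (Set.range H.row)
  rw [← rank_eq_finrank_span_row, hr] at h
  obtain ⟨f, hf, hspan, -⟩ := h
  choose s hs using hf
  have hmem : ∀ u, ∃ c : Fin r → ℂ, ∑ i, c i • f i = H.row u := fun u => by
    rw [← Submodule.mem_span_range_iff_exists_fun, hspan]
    exact Submodule.subset_span ⟨u, rfl⟩
  choose C hC using hmem
  -- The rows `s` span the row space; by Hermitian symmetry the columns `s` span with the conjugate
  -- coefficients. So `H` factors through its principal submatrix on `s`, which must have full rank
  -- `r`.
  have h1 : H = of C * H.submatrix s id := by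
    ext u j
    simpa [Matrix.mul_apply, ← hs] using (congrFun (hC u) j).symm
  have h2 : H.submatrix s id = H.submatrix s s * (of C)ᴴ := by
    have : H = H.submatrix id s * (of C)ᴴ := by
      have := congrArg conjTranspose h1
      rwa [conjTranspose_mul, conjTranspose_submatrix, hH.eq] at this
    conv_lhs => rw [this]
    rfl
  have h3 : r ≤ (H.submatrix s s).rank := by
    refine hr.symm.le.trans ?_
    conv_lhs => rw [h1, h2]
    exact (rank_mul_le_right _ _).trans (rank_mul_le_left _ _)
  refine ⟨s, fun h0 => ?_⟩
  obtain ⟨v, hv, hv0⟩ := exists_vecMul_eq_zero_iff.mpr h0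
  refine hv (funext fun i => ?_)
  have hfin : LinearIndependent ℂ (H.submatrix s s).row := by
    rw [linearIndependent_iff_card_eq_finrank_span, Set.finrank, ← rank_eq_finrank_span_row,
      Fintype.card_fin]
    exact le_antisymm h3 (by simpa using (H.submatrix s s).rank_le_card_width)
  refine Fintype.linearIndependent_iff.mp hfin v ?_ i
  ext j
  simpa [Matrix.vecMul, dotProduct] using congrFun hv0 j

/-- The determinant of a `4 × 4` matrix with zero diagonal. -/
theorem det_fin_four_of_diag_eq_zero {R : Type*} [CommRing R] (A : Matrix (Fin 4) (Fin 4) R)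
    (h0 : ∀ i, A i i = 0) :
    A.det = A 0 1 * A 1 0 * (A 2 3 * A 3 2) + A 0 2 * A 2 0 * (A 1 3 * A 3 1) +
        A 0 3 * A 3 0 * (A 1 2 * A 2 1) -
        (A 0 1 * A 1 2 * A 2 3 * A 3 0 + A 0 3 * A 3 2 * A 2 1 * A 1 0) -
        (A 0 1 * A 1 3 * A 3 2 * A 2 0 + A 0 2 * A 2 3 * A 3 1 * A 1 0) -
        (A 0 2 * A 2 1 * A 1 3 * A 3 0 + A 0 3 * A 3 1 * A 1 2 * A 2 0) := by
  rw [det_succ_row_zero]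
  simp only [Fin.sum_univ_four, det_fin_three, submatrix_apply, h0]
  simp only [Fin.succAbove, Fin.reduceSucc, Fin.reduceCastSucc, Fin.reduceLT, if_true, if_false,
    Fin.isValue, h0, Fin.val_zero, Fin.val_one, Fin.val_two]
  norm_num [h0]
  ring

end Matrix

/-! ### Hermitian matrices of rank three with sixth roots of unity as entries -/

namespace MixedGraph

/-- Hermitian matrices with zero diagonal whose entries are zero or sixth roots of unity. -/
structure IsSixthGain {ι : Type*} (H : Matrix ι ι ℂ) : Prop where
  diag : ∀ i, H i i = 0
  star_apply : ∀ i j, star (H i j) = H j i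
  pow_six : ∀ i j, H i j = 0 ∨ H i j ^ 6 = 1

theorem sixthRoot_injective : Function.Injective sixthRoot := by
  intro k l h
  have h1 := sixthRoot_add_sixthRoot_neg (k - l)
  rw [neg_sub, sub_eq_add_neg, sub_eq_add_neg, sixthRoot_add, sixthRoot_add, h,
    sixthRoot_mul_neg, ← h, sixthRoot_mul_neg] at h1
  have h2 : twoRe (k - l) = 2 := by
    rw [sub_eq_add_neg]; exact_mod_cast h1.symm.trans (one_add_one_eq_two (R := ℂ))
  have : ∀ x, twoRe x = 2 → x = 0 := by decide
  exact sub_eq_zero.mp (this _ h2)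

/-- Here `p, q, r` are the exponents of the triangles `abc`, `acd`, `abd`, and the hypothesis is the
vanishing of the minor on `a, b, c, d`. The six alternatives are the six orders of `b, c, d`;
reversing a triangle negates its exponent. -/
theorem exists_transitive_order :
    ∀ p q r : ZMod 6, twoRe (p + q) + twoRe (q + -r) + twoRe (-r + p) = 3 →
      ∃ z : ZMod 6, (z = 1 ∨ z = 2) ∧
        ((p = z ∧ q = z ∧ r = z) ∨ (r = z ∧ -q = z ∧ p = z) ∨ (-p = z ∧ r = z ∧ q = z) ∨
          (q = z ∧ -r = z ∧ -p = z) ∨ (-r = z ∧ p = z ∧ -q = z) ∨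
            (-q = z ∧ -p = z ∧ -r = z)) := by
  decide

set_option maxRecDepth 100000 in
-- The variable `xy` is the exponent of the triangle `a, x, y`, and the hypotheses are the vanishing
-- minors on `a` with three of `b, c, d, w`. Each alternative says that two of these four vertices
-- agree towards the other two. The hypotheses are interleaved with the quantifiers so that the
-- search is cut early.
theorem exists_agreeing_pair :
    ∀ bc cd bd : ZMod 6, twoRe (bc + cd) + twoRe (cd + -bd) + twoRe (-bd + bc) = 3 →
    ∀ cw bw : ZMod 6, twoRe (bc + cw) + twoRe (cw + -bw) + twoRe (-bw + bc) = 3 →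
    ∀ dw : ZMod 6, twoRe (bd + dw) + twoRe (dw + -bw) + twoRe (-bw + bd) = 3 →
      twoRe (cd + dw) + twoRe (dw + -cw) + twoRe (-cw + cd) = 3 →
      (bd = cd ∧ bw = cw) ∨ (bc = -cd ∧ bw = dw) ∨ (bc = -cw ∧ bd = -dw) ∨
        (-bc = -bd ∧ cw = dw) ∨ (-bc = -bw ∧ cd = -dw) ∨ (-bd = -bw ∧ -cd = -cw) := by
  decide

namespace IsSixthGain

variable {ι : Type*} {H : Matrix ι ι ℂ}

theorem ne_zero_symm (hH : IsSixthGain H) {i j : ι} (h : H i j ≠ 0) : H j i ≠ 0 := by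
  rw [← hH.star_apply]; exact star_ne_zero.mpr h

theorem isHermitian (hH : IsSixthGain H) : H.IsHermitian := by
  ext i j; exact hH.star_apply j i

/-- The exponents of the nonzero entries. -/
theorem exists_exponent (hH : IsSixthGain H) : ∃ e : ι → ι → ZMod 6,
    (∀ i j, H i j ≠ 0 → H i j = sixthRoot (e i j)) ∧ ∀ i j, H i j ≠ 0 → e j i = -e i j := by
  have : ∀ i j, ∃ k, H i j ≠ 0 → H i j = sixthRoot k := fun i j => by
    rcases hH.pow_six i j with h | h
    · exact ⟨0, fun h' => absurd h h'⟩
    · obtain ⟨k, hk⟩ := exists_sixthRoot_eq h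
      exact ⟨k, fun _ => hk⟩
  choose e he using this
  refine ⟨e, he, fun i j h => sixthRoot_injective ?_⟩
  rw [← he j i (hH.ne_zero_symm h), ← star_sixthRoot, ← he i j h, hH.star_apply]

theorem det_three (hH : IsSixthGain H) (a b c : ι) :
    (H.submatrix ![a, b, c] ![a, b, c]).det =
      H a b * H b c * H c a + H a c * H c b * H b a := by
  rw [Matrix.det_fin_three]
  simp [hH.diag]
  ring

theorem det_four (hH : IsSixthGain H) (a b c d : ι) :
    (H.submatrix ![a, b, c, d] ![a, b, c, d]).det =
      H a b * H b a * (H c d * H d c) + H a c * H c a * (H b d * H d b) +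
        H a d * H d a * (H b c * H c b) -
        (H a b * H b c * H c d * H d a + H a d * H d c * H c b * H b a) -
        (H a b * H b d * H d c * H c a + H a c * H c d * H d b * H b a) -
        (H a c * H c b * H b d * H d a + H a d * H d b * H b c * H c a) := by
  rw [Matrix.det_fin_four_of_diag_eq_zero _ fun i => hH.diag _]
  rfl

/-- The minor is twice the real part of a sixth root of unity, hence `±1` or `±2`. -/
theorem det_triangle_ne_zero (hH : IsSixthGain H) {a b c : ι} (hab : H a b ≠ 0)
    (hbc : H b c ≠ 0) (hca : H c a ≠ 0) :
    (H.submatrix ![a, b, c] ![a, b, c]).det ≠ 0 := by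
  obtain ⟨e, he, hs⟩ := hH.exists_exponent
  rw [hH.det_three, he _ _ hab, he _ _ hbc, he _ _ hca, he _ _ (hH.ne_zero_symm hab),
    he _ _ (hH.ne_zero_symm hbc), he _ _ (hH.ne_zero_symm hca), hs _ _ hab, hs _ _ hbc,
    hs _ _ hca]
  have : ∀ k, twoRe k ≠ 0 := by decide
  simp only [← sixthRoot_add]
  rw [show -e c a + -e b c + -e a b = -(e a b + e b c + e c a) by ring,
    sixthRoot_add_sixthRoot_neg]
  exact_mod_cast this _

theorem ne_zero_of_det_three_ne_zero (hH : IsSixthGain H) {a b c : ι}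
    (h : (H.submatrix ![a, b, c] ![a, b, c]).det ≠ 0) :
    H a b ≠ 0 ∧ H b c ≠ 0 ∧ H c a ≠ 0 := by
  refine ⟨?_, ?_, ?_⟩ <;>
  · intro h0
    have h0' := hH.star_apply _ _ ▸ congrArg star h0
    rw [star_zero] at h0'
    exact h (by rw [hH.det_three, h0, h0']; ring)

/-- The vertices can be ordered so that they form a complete graph on four vertices all of whose
triangles `0, i, j` with `i < j` have gain `ω ^ z`. -/
def IsTransitiveK4 (H : Matrix ι ι ℂ) (z : ZMod 6) : Prop :=
  ∃ s : Fin 4 ≃ ι, (∀ i j, i ≠ j → H (s i) (s j) ≠ 0) ∧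
    ∀ i j, 0 < i → i < j → H (s 0) (s i) * H (s i) (s j) * H (s j) (s 0) = sixthRoot z

theorem isTransitiveK4_of_exponents (hH : IsSixthGain H) {e : ι → ι → ZMod 6}
    (he : ∀ i j, H i j ≠ 0 → H i j = sixthRoot (e i j)) {a x y z : ι} (hax : H a x ≠ 0)
    (hay : H a y ≠ 0) (haz : H a z ≠ 0) (hxy : H x y ≠ 0) (hyz : H y z ≠ 0) (hxz : H x z ≠ 0)
    (hall : ∀ v, v = a ∨ v = x ∨ v = y ∨ v = z) {k : ZMod 6} (h1 : e a x + e x y + e y a = k)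
    (h2 : e a y + e y z + e z a = k) (h3 : e a x + e x z + e z a = k) : IsTransitiveK4 H k := by
  have hz := @ne_zero_symm _ _ hH
  have hne : ∀ i j : Fin 4, i ≠ j → H (![a, x, y, z] i) (![a, x, y, z] j) ≠ 0 := by
    intro i j hij
    fin_cases i <;> fin_cases j <;> first | exact absurd rfl hij | assumption | (apply hz; assumption)
  have hbij : Function.Bijective ![a, x, y, z] := by
    refine ⟨fun i j hij => ?_, fun v => ?_⟩
    · by_contra h
      exact hne i j h (by rw [hij, hH.diag])
    · rcases hall v with rfl | rfl | rfl | rfl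
      exacts [⟨0, rfl⟩, ⟨1, rfl⟩, ⟨2, rfl⟩, ⟨3, rfl⟩]
  refine ⟨Equiv.ofBijective _ hbij, hne, fun i j hi hij => ?_⟩
  have : ∀ u v, H a u ≠ 0 → H u v ≠ 0 → H a v ≠ 0 → e a u + e u v + e v a = k →
      H a u * H u v * H v a = sixthRoot k := fun u v h1 h2 h3 h => by
    rw [he _ _ h1, he _ _ h2, he _ _ (hz h3), ← sixthRoot_add, ← sixthRoot_add, h]
  fin_cases i <;> fin_cases j <;> first | (exfalso; revert hi hij; decide) | (apply this <;> assumption)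

variable [Fintype ι]

theorem det_four_eq_zero (hr : H.rank = 3) (a b c d : ι) :
    (H.submatrix ![a, b, c, d] ![a, b, c, d]).det = 0 := by
  by_contra h
  have h1 := H.rank_submatrix_le ![a, b, c, d] ![a, b, c, d]
  rw [Matrix.rank_of_det_ne_zero h, hr] at h1
  simp at h1

/-- The columns of a triangle carry a nonsingular submatrix of full rank, so proportionality of two
rows there extends to all columns. -/
theorem row_eq_of_triangle (hH : IsSixthGain H) (hr : H.rank = 3) {a b c : ι} (hab : H a b ≠ 0)
    (hbc : H b c ≠ 0) (hca : H c a ≠ 0) {u v : ι} {k : ℂ} (ha : H u a = k * H v a)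
    (hb : H u b = k * H v b) (hc : H u c = k * H v c) (j : ι) : H u j = k * H v j := by
  refine Matrix.row_eq_of_eq_on (hH.det_triangle_ne_zero hab hbc hca) (by simpa using hr) ?_ j
  intro i
  fin_cases i <;> assumption

/-- In a reduced matrix of rank three, a vertex is adjacent to all vertices of a triangle. -/
theorem ne_zero_of_triangle (hH : IsSixthGain H) (hr : H.rank = 3)
    (hrow : ∀ i, ∃ j, H i j ≠ 0)
    (hred : ∀ i j (c : ℂ), c ^ 6 = 1 → (∀ l, H i l = c * H j l) → i = j)
    {a b c d : ι} (hab : H a b ≠ 0) (hbc : H b c ≠ 0) (hca : H c a ≠ 0) (hda : d ≠ a) :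
    H d a ≠ 0 := by
  intro h
  have h' : H a d = 0 := by rw [← hH.star_apply, h, star_zero]
  have hdet := det_four_eq_zero hr a b c d
  rw [hH.det_four, h, h'] at hdet
  obtain ⟨e, he, hs⟩ := hH.exists_exponent
  have hmul : ∀ i j, H i j ≠ 0 → H i j * H j i = 1 := fun i j hij => by
    rw [he _ _ hij, he _ _ (hH.ne_zero_symm hij), hs _ _ hij, sixthRoot_mul_neg]
  by_cases hdb : H d b = 0
  · have hbd : H b d = 0 := by rw [← hH.star_apply, hdb, star_zero]
    by_cases hdc : H d c = 0
    · obtain ⟨j, hj⟩ := hrow d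
      refine hj ?_
      -- With `k = 0`: a row vanishing on the triangle vanishes everywhere.
      rw [hH.row_eq_of_triangle hr hab hbc hca (u := d) (v := d) (k := 0)
        (by simpa) (by simpa) (by simpa), zero_mul]
    · rw [hdb, hbd, hmul _ _ hab, hmul _ _ (hH.ne_zero_symm hdc)] at hdet
      norm_num at hdet
  · by_cases hdc : H d c = 0
    · have hcd : H c d = 0 := by rw [← hH.star_apply, hdc, star_zero]
      rw [hdc, hcd, hmul _ _ (hH.ne_zero_symm hca), hmul _ _ (hH.ne_zero_symm hdb)] at hdet
      norm_num at hdet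
    · rw [hmul _ _ hab, hmul _ _ (hH.ne_zero_symm hdc), hmul _ _ (hH.ne_zero_symm hca),
        hmul _ _ (hH.ne_zero_symm hdb), he _ _ hab, he _ _ (hH.ne_zero_symm hab),
        he _ _ hca, he _ _ (hH.ne_zero_symm hca), he _ _ hdb, he _ _ (hH.ne_zero_symm hdb),
        he _ _ hdc, he _ _ (hH.ne_zero_symm hdc), hs _ _ hab, hs _ _ hca, hs _ _ hdb,
        hs _ _ hdc] at hdet
      have h2 := sixthRoot_add_sixthRoot_neg (e a b + -e d b + e d c + e c a)
      rw [show -(e a b + -e d b + e d c + e c a) = -e c a + -e d c + e d b + -e a b by ring] at h2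
      simp only [sixthRoot_add] at h2
      -- The minor is 2 minus twice the real part of the gain of the 4-cycle `a, b, d, c`, so this
      -- gain is 1.
      have h3 : (twoRe (e a b + -e d b + e d c + e c a) : ℂ) = 2 := by
        linear_combination -hdet - h2
      have h4 : ∀ x, twoRe x = 2 → x = 0 := by decide
      have h5 := h4 _ (by exact_mod_cast h3)
      -- The factor is read off at column `b`; the trivial gain of the 4-cycle makes it fit at `c`
      -- as well, and both entries at column `a` are zero.
      refine hda (hred d a (sixthRoot (e d b + -e a b)) (sixthRoot_pow_six _)
        (hH.row_eq_of_triangle hr hab hbc hca ?_ ?_ ?_))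
      · rw [h, hH.diag, mul_zero]
      · rw [he _ _ hdb, he _ _ hab, ← sixthRoot_add, neg_add_cancel_right]
      · rw [he _ _ hdc, he _ _ (hH.ne_zero_symm hca), hs _ _ hca, ← sixthRoot_add]
        congr 1
        linear_combination h5

/-- The equation which a singular `4 × 4` matrix without zeros off the diagonal imposes on the
exponents of its triangles. -/
theorem exponent_eq (hH : IsSixthGain H) (hr : H.rank = 3) {e : ι → ι → ZMod 6}
    (he : ∀ i j, H i j ≠ 0 → H i j = sixthRoot (e i j))
    (hs : ∀ i j, H i j ≠ 0 → e j i = -e i j) {a b c d : ι} (hab : H a b ≠ 0) (hac : H a c ≠ 0)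
    (had : H a d ≠ 0) (hbc : H b c ≠ 0) (hbd : H b d ≠ 0) (hcd : H c d ≠ 0) :
    twoRe (e a b + e b c + e c a + (e a c + e c d + e d a)) +
      twoRe (e a c + e c d + e d a + -(e a b + e b d + e d a)) +
      twoRe (-(e a b + e b d + e d a) + (e a b + e b c + e c a)) = 3 := by
  have hdet := det_four_eq_zero hr a b c d
  rw [hH.det_four, he _ _ hab, he _ _ hac, he _ _ had, he _ _ hbc, he _ _ hbd, he _ _ hcd,
    he _ _ (hH.ne_zero_symm hab), he _ _ (hH.ne_zero_symm hac), he _ _ (hH.ne_zero_symm had),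
    he _ _ (hH.ne_zero_symm hbc), he _ _ (hH.ne_zero_symm hbd), he _ _ (hH.ne_zero_symm hcd),
    hs _ _ hab, hs _ _ hac, hs _ _ had, hs _ _ hbc, hs _ _ hbd, hs _ _ hcd] at hdet
  rw [hs _ _ hac, hs _ _ had]
  simp only [← sixthRoot_add] at hdet
  -- The three 4-cycles on `a, b, c, d`: each is composed of two of the triangles `abc`, `acd`,
  -- `abd`, traversed so that their common edge cancels.
  have h1 := sixthRoot_add_sixthRoot_neg (e a b + e b c + e c d + -e a d)
  have h2 := sixthRoot_add_sixthRoot_neg (e a c + e c d + -e b d + -e a b)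
  have h3 := sixthRoot_add_sixthRoot_neg (e a d + -e b d + e b c + -e a c)
  rw [show e a b + e b c + -e a c + (e a c + e c d + -e a d) =
      e a b + e b c + e c d + -e a d by ring,
    show e a c + e c d + -e a d + -(e a b + e b d + -e a d) =
      e a c + e c d + -e b d + -e a b by ring,
    show -(e a b + e b d + -e a d) + (e a b + e b c + -e a c) =
      e a d + -e b d + e b c + -e a c by ring]
  rw [show -(e a b + e b c + e c d + -e a d) = e a d + -e c d + -e b c + -e a b by ring] at h1
  rw [show -(e a c + e c d + -e b d + -e a b) = e a b + e b d + -e c d + -e a c by ring] at h2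
  rw [show -(e a d + -e b d + e b c + -e a c) = e a c + -e b c + e b d + -e a d by ring] at h3
  have : (twoRe (e a b + e b c + e c d + -e a d) : ℂ) +
      twoRe (e a c + e c d + -e b d + -e a b) + twoRe (e a d + -e b d + e b c + -e a c) = 3 := by
    simp only [add_neg_cancel, add_zero, sixthRoot_zero] at hdet
    linear_combination -hdet - h1 - h2 - h3
  exact_mod_cast this

/-- Two vertices with the same triangle exponents over `a, r` and `a, s` are not adjacent. -/
theorem eq_zero_of_agree (hH : IsSixthGain H) (hr : H.rank = 3) {e : ι → ι → ZMod 6}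
    (he : ∀ i j, H i j ≠ 0 → H i j = sixthRoot (e i j))
    (hs : ∀ i j, H i j ≠ 0 → e j i = -e i j) {a r s p q : ι} (har : H a r ≠ 0) (hrs : H r s ≠ 0)
    (hsa : H s a ≠ 0) (hap : H a p ≠ 0) (haq : H a q ≠ 0) (hpr : H p r ≠ 0) (hqr : H q r ≠ 0)
    (hps : H p s ≠ 0) (hqs : H q s ≠ 0)
    (h1 : e a p + e p r + e r a = e a q + e q r + e r a)
    (h2 : e a p + e p s + e s a = e a q + e q s + e s a) : H p q = 0 := by
  rw [hH.row_eq_of_triangle hr har hrs hsa (u := p) (v := q) (k := sixthRoot (e a q + -e a p))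
    ?_ ?_ ?_, hH.diag, mul_zero]
  · rw [he _ _ (hH.ne_zero_symm hap), he _ _ (hH.ne_zero_symm haq), ← sixthRoot_add, hs _ _ hap,
      hs _ _ haq]
    congr 1; ring
  · rw [he _ _ hpr, he _ _ hqr, ← sixthRoot_add]
    congr 1; linear_combination h1
  · rw [he _ _ hps, he _ _ hqs, ← sixthRoot_add]
    congr 1; linear_combination h2

/-- No five vertices are pairwise adjacent. -/
theorem false_of_five (hH : IsSixthGain H) (hr : H.rank = 3) {a b c d w : ι}
    (hab : H a b ≠ 0) (hac : H a c ≠ 0) (had : H a d ≠ 0) (haw : H a w ≠ 0) (hbc : H b c ≠ 0)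
    (hbd : H b d ≠ 0) (hbw : H b w ≠ 0) (hcd : H c d ≠ 0) (hcw : H c w ≠ 0) (hdw : H d w ≠ 0) :
    False := by
  obtain ⟨e, he, hs⟩ := hH.exists_exponent
  have hneg : ∀ x y, H a x ≠ 0 → H a y ≠ 0 → H x y ≠ 0 →
      -(e a x + e x y + e y a) = e a y + e y x + e x a := fun x y hx hy hxy => by
    rw [hs _ _ hx, hs _ _ hy, hs _ _ hxy]; ring
  have hz := @ne_zero_symm _ _ hH
  have agree := @eq_zero_of_agree _ _ _ hH hr e he hs
  -- Each alternative provides an agreeing pair, which would be non-adjacent by `eq_zero_of_agree`.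
  -- The minor on `b, c, d, w` is not needed.
  rcases exists_agreeing_pair _ _ _ (hH.exponent_eq hr he hs hab hac had hbc hbd hcd) _ _
    (hH.exponent_eq hr he hs hab hac haw hbc hbw hcw) _
    (hH.exponent_eq hr he hs hab had haw hbd hbw hdw)
    (hH.exponent_eq hr he hs hac had haw hcd hcw hdw) with
    ⟨h1, h2⟩ | ⟨h1, h2⟩ | ⟨h1, h2⟩ | ⟨h1, h2⟩ | ⟨h1, h2⟩ | ⟨h1, h2⟩
  · exact hbc (agree had hdw (hz haw) hab hac hbd hcd hbw hcw h1 h2)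
  · rw [hneg _ _ hac had hcd] at h1
    exact hbd (agree hac hcw (hz haw) hab had hbc (hz hcd) hbw hdw h1 h2)
  · rw [hneg _ _ hac haw hcw] at h1
    rw [hneg _ _ had haw hdw] at h2
    exact hbw (agree hac hcd (hz had) hab haw hbc (hz hcw) hbd (hz hdw) h1 h2)
  · rw [hneg _ _ hab hac hbc, hneg _ _ hab had hbd] at h1
    exact hcd (agree hab hbw (hz haw) hac had (hz hbc) (hz hbd) hcw hdw h1 h2)
  · rw [hneg _ _ hab hac hbc, hneg _ _ hab haw hbw] at h1
    rw [hneg _ _ had haw hdw] at h2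
    exact hcw (agree hab hbd (hz had) hac haw (hz hbc) (hz hbw) hcd (hz hdw) h1 h2)
  · rw [hneg _ _ hab had hbd, hneg _ _ hab haw hbw] at h1
    rw [hneg _ _ hac had hcd, hneg _ _ hac haw hcw] at h2
    exact hdw (agree hab hbc (hz hac) had haw (hz hbd) (hz hbw) (hz hcd) (hz hcw) h1 h2)

/-- Classification of the reduced matrices of rank three. -/
theorem classification (hH : IsSixthGain H) (hr : H.rank = 3)
    (hrow : ∀ i, ∃ j, H i j ≠ 0)
    (hred : ∀ i j (c : ℂ), c ^ 6 = 1 → (∀ l, H i l = c * H j l) → i = j) :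
    (∃ s : Fin 3 ≃ ι, ∀ i j, i ≠ j → H (s i) (s j) ≠ 0) ∨ IsTransitiveK4 H 1 ∨
      IsTransitiveK4 H 2 := by
  have hz := @ne_zero_symm _ _ hH
  have hadj := @ne_zero_of_triangle _ _ _ hH hr hrow hred
  obtain ⟨a, b, c, hab, hbc, hca⟩ : ∃ a b c, H a b ≠ 0 ∧ H b c ≠ 0 ∧ H c a ≠ 0 := by
    obtain ⟨s, hs⟩ := Matrix.exists_principal_minor_ne_zero hH.isHermitian hr
    have hs3 : s = ![s 0, s 1, s 2] := by ext i; fin_cases i <;> rfl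
    rw [hs3] at hs
    exact ⟨_, _, _, hH.ne_zero_of_det_three_ne_zero hs⟩
  by_cases h3 : ∀ v, v = a ∨ v = b ∨ v = c
  · left
    have hne : ∀ i j : Fin 3, i ≠ j → H (![a, b, c] i) (![a, b, c] j) ≠ 0 := by
      intro i j hij
      fin_cases i <;> fin_cases j <;>
        first | exact absurd rfl hij | assumption | (apply hz; assumption)
    refine ⟨Equiv.ofBijective ![a, b, c] ⟨fun i j hij => ?_, fun v => ?_⟩, hne⟩
    · by_contra h
      exact hne i j h (by rw [hij, hH.diag])
    · rcases h3 v with rfl | rfl | rfl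
      exacts [⟨0, rfl⟩, ⟨1, rfl⟩, ⟨2, rfl⟩]
  right
  push Not at h3
  obtain ⟨d, hda, hdb, hdc⟩ := h3
  have had := hz (hadj hab hbc hca hda)
  have hbd := hz (hadj hbc hca hab hdb)
  have hcd := hz (hadj hca hab hbc hdc)
  have hac := hz hca
  by_cases h4 : ∀ v, v = a ∨ v = b ∨ v = c ∨ v = d
  · obtain ⟨e, he, hs⟩ := hH.exists_exponent
    have hneg : ∀ x y, H a x ≠ 0 → H a y ≠ 0 → H x y ≠ 0 →
        -(e a x + e x y + e y a) = e a y + e y x + e x a := fun x y hx hy hxy => by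
      rw [hs _ _ hx, hs _ _ hy, hs _ _ hxy]; ring
    have hK : ∃ z : ZMod 6, (z = 1 ∨ z = 2) ∧ IsTransitiveK4 H z := by
      have mk := @isTransitiveK4_of_exponents _ _ hH e he
      obtain ⟨z, hz12, h⟩ := exists_transitive_order _ _ _
        (hH.exponent_eq hr he hs hab hac had hbc hbd hcd)
      refine ⟨z, hz12, ?_⟩
      rw [hneg _ _ hab hac hbc, hneg _ _ hac had hcd, hneg _ _ hab had hbd] at h
      rcases h with ⟨h1, h2, h3⟩ | ⟨h1, h2, h3⟩ | ⟨h1, h2, h3⟩ | ⟨h1, h2, h3⟩ | ⟨h1, h2, h3⟩ |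
        ⟨h1, h2, h3⟩
      · exact mk hab hac had hbc hcd hbd h4 h1 h2 h3
      · exact mk hab had hac hbd (hz hcd) hbc (fun v => by rcases h4 v with h | h | h | h <;> simp [h]) h1 h2 h3
      · exact mk hac hab had (hz hbc) hbd hcd (fun v => by rcases h4 v with h | h | h | h <;> simp [h]) h1 h2 h3
      · exact mk hac had hab hcd (hz hbd) (hz hbc) (fun v => by rcases h4 v with h | h | h | h <;> simp [h]) h1 h2 h3
      · exact mk had hab hac (hz hbd) hbc (hz hcd) (fun v => by rcases h4 v with h | h | h | h <;> simp [h]) h1 h2 h3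
      · exact mk had hac hab (hz hcd) (hz hbc) (hz hbd) (fun v => by rcases h4 v with h | h | h | h <;> simp [h]) h1 h2 h3
    obtain ⟨z, rfl | rfl, h⟩ := hK
    exacts [Or.inl h, Or.inr h]
  · push Not at h4
    obtain ⟨w, hwa, hwb, hwc, hwd⟩ := h4
    exact (hH.false_of_five hr hab hac had (hz (hadj hab hbc hca hwa)) hbc hbd
      (hz (hadj hbc hca hab hwb)) hcd (hz (hadj hca hab hbc hwc))
      (hz (hadj (hz had) hab hbd hwd))).elim

end IsSixthGain

variable {V : Type*} {W : Type*}

theorem isSixthGain_N (M : MixedGraph V) : IsSixthGain M.N :=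
  ⟨M.N_self, M.star_N, M.N_pow_six⟩

/-! ### Invariance of the rank -/

theorem rank_diagonal_mul_mul_diagonal [Fintype V] [DecidableEq V] {A : Matrix V V ℂ} {f g : V → ℂ}
    (hf : ∀ v, f v ≠ 0) (hg : ∀ v, g v ≠ 0) :
    (Matrix.diagonal f * A * Matrix.diagonal g).rank = A.rank := by
  rw [Matrix.rank_mul_eq_left_of_det_ne_zero, Matrix.rank_mul_eq_right_of_det_ne_zero]
  all_goals
    rw [Matrix.det_diagonal]
    exact Finset.prod_ne_zero_iff.mpr fun v _ => by simp [hf, hg]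

theorem SwitchingEquivalent.rank_eq [Fintype V] {M M' : MixedGraph V}
    (h : M.SwitchingEquivalent M') : M'.rank = M.rank := by
  classical
  obtain ⟨f, hf, h⟩ := h.exists_N_eq
  have hf0 : ∀ v, f v ≠ 0 := fun v h => by simpa [h] using hf v
  have key : ∀ A : Matrix V V ℂ, (∀ u v, M'.N u v = (f u)⁻¹ * A u v * f v) →
      M'.rank = A.rank := fun A hA => by
    rw [← rank_diagonal_mul_mul_diagonal (A := A) (fun v => inv_ne_zero (hf0 v)) hf0, rank]
    congr 1
    ext u v
    rw [Matrix.mul_diagonal, Matrix.diagonal_mul, hA]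
  rcases h with h | h
  · exact key M.N h
  · exact (key M.N.transpose h).trans (Matrix.rank_transpose _)

theorem Isomorphic.rank_eq [Fintype V] [Fintype W] {M : MixedGraph V} {M' : MixedGraph W}
    (h : M.Isomorphic M') : M.rank = M'.rank := by
  obtain ⟨e, hG, hA⟩ := h
  have : M.N = M'.N.submatrix e e := by
    ext u v
    have h1 := hG u v
    have h2 := hA u v
    have h3 := hA v u
    simp only [Matrix.submatrix_apply]
    unfold N
    split_ifs <;> simp_all
  rw [rank, this, Matrix.rank_submatrix, rank]

theorem SwitchingEquivalentTo.rank_eq [Fintype V] [Fintype W] {M : MixedGraph V}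
    {F : MixedGraph W} (h : M.SwitchingEquivalentTo F) : M.rank = F.rank := by
  obtain ⟨M', h, h'⟩ := h
  rw [← h.rank_eq, h'.rank_eq]

theorem IsTwinTransversal.exists_N_eq {M : MixedGraph V} {S : Set V} (hS : M.IsTwinTransversal S) :
    ∃ (t : V → S) (k : V → ℂ), (∀ v, k v ^ 6 = 1) ∧ (∀ u v, M.N u v = k u * M.N (t u) v) ∧
      ∀ u v, M.N u v = star (k v) * M.N u (t v) := by
  have : ∀ v, ∃ (s : S) (c : ℂ), c ^ 6 = 1 ∧ ∀ j, M.N v j = c * M.N s j := fun v => by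
    obtain ⟨s, hs, h⟩ := hS.1 v
    exact ⟨⟨s, hs⟩, h.exists_N_eq⟩
  choose t k hk h using this
  refine ⟨t, k, hk, h, fun u v => ?_⟩
  rw [← star_N, h, star_mul, star_N, mul_comm]

/-- The full matrix arises from the reduced one by repeating rows and columns and rescaling them by
nonzero factors. -/
theorem IsTwinTransversal.rank_induce [Fintype V] {M : MixedGraph V} {S : Set V} [Fintype S]
    (hS : M.IsTwinTransversal S) : (M.induce S).rank = M.rank := by
  classical
  obtain ⟨t, k, hk, hrow, hcol⟩ := hS.exists_N_eq
  have hk0 : ∀ v, k v ≠ 0 := fun v h => by simpa [h] using hk v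
  have hsub : (M.induce S).N = M.N.submatrix (fun s : S => (s : V)) (fun s : S => (s : V)) := rfl
  have h1 : (M.induce S).rank ≤ M.rank := by
    rw [rank, hsub]
    exact M.N.rank_submatrix_le _ _
  refine le_antisymm h1 ?_
  have h2 : M.N = Matrix.diagonal k * (M.induce S).N.submatrix t t * Matrix.diagonal (star k) := by
    ext u v
    rw [Matrix.mul_diagonal, Matrix.diagonal_mul, hrow, hcol, Pi.star_apply, hsub,
      Matrix.submatrix_apply, Matrix.submatrix_apply]
    ring
  have h3 := rank_diagonal_mul_mul_diagonal (A := (M.induce S).N.submatrix t t) hk0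
    (g := star k) (fun v => star_ne_zero.mpr (hk0 v))
  rw [← h2] at h3
  exact h3.le.trans (Matrix.rank_submatrix_le _ _ _)

/-! ### The graphs of rank three -/

theorem IsSixthGain.three_le_rank {ι : Type*} [Fintype ι] {H : Matrix ι ι ℂ} (hH : IsSixthGain H)
    {a b c : ι} (hab : H a b ≠ 0) (hbc : H b c ≠ 0) (hca : H c a ≠ 0) : 3 ≤ H.rank := by
  have h := H.rank_submatrix_le ![a, b, c] ![a, b, c]
  rwa [Matrix.rank_of_det_ne_zero (hH.det_triangle_ne_zero hab hbc hca), Fintype.card_fin] at h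

theorem IsMixedTriangle.rank_eq [Fintype V] {M : MixedGraph V} (h : M.IsMixedTriangle) :
    M.rank = 3 := by
  obtain ⟨φ⟩ := h
  refine le_antisymm ?_ ?_
  · refine M.N.rank_le_card_width.trans ?_
    rw [Fintype.card_congr φ.toEquiv, Fintype.card_fin]
  · have key : ∀ i j : Fin 3, i ≠ j → M.N (φ.symm i) (φ.symm j) ≠ 0 := fun i j hij => by
      rw [ne_eq, N_eq_zero, not_not, φ.symm.map_adj_iff]
      exact hij
    exact M.isSixthGain_N.three_le_rank (key 0 1 (by decide)) (key 1 2 (by decide))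
      (key 2 0 (by decide))

theorem rank_eq_three_of_det_eq_zero {F : MixedGraph (Fin 4)} (hF : F.graph = ⊤)
    (hdet : F.N.det = 0) : F.rank = 3 := by
  have key : ∀ i j : Fin 4, i ≠ j → F.N i j ≠ 0 := fun i j hij => by
    rw [ne_eq, N_eq_zero, not_not, hF]
    exact hij
  refine le_antisymm ?_ (F.isSixthGain_N.three_le_rank (key 0 1 (by decide)) (key 1 2 (by decide))
      (key 2 0 (by decide)))
  by_contra! h
  have h4 : F.N.rank = 4 := le_antisymm (by simpa using F.N.rank_le_card_width) h
  have hli : LinearIndependent ℂ F.N.row := by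
    rw [linearIndependent_iff_card_eq_finrank_span, Set.finrank, ← Matrix.rank_eq_finrank_span_row,
      h4, Fintype.card_fin]
  rw [Matrix.linearIndependent_rows_iff_isUnit, Matrix.isUnit_iff_isUnit_det, hdet] at hli
  exact not_isUnit_zero hli

theorem mixedK4e_N : mixedK4e.N = !![0, 1, 1, 1; 1, 0, omega, omega; 1, omegaBar, 0, omega;
    1, omegaBar, omegaBar, 0] := by
  ext i j
  fin_cases i <;> fin_cases j <;> simp [N, mixedK4e]

theorem mixedK4f_N : mixedK4f.N = !![0, omega, 1, omegaBar; omegaBar, 0, omega, 1;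
    1, omegaBar, 0, omega; omega, 1, omegaBar, 0] := by
  ext i j
  fin_cases i <;> fin_cases j <;> simp [N, mixedK4f]

theorem rank_mixedK4e : mixedK4e.rank = 3 := by
  refine rank_eq_three_of_det_eq_zero rfl ?_
  rw [Matrix.det_fin_four_of_diag_eq_zero _ (N_self _), mixedK4e_N, omegaBar_eq]
  simp
  linear_combination -omega_sq

theorem rank_mixedK4f : mixedK4f.rank = 3 := by
  refine rank_eq_three_of_det_eq_zero rfl ?_
  rw [Matrix.det_fin_four_of_diag_eq_zero _ (N_self _), mixedK4f_N, omegaBar_eq]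
  simp
  ring

/-- Two mixed complete graphs on four vertices with the same gains of the triangles `0, i, j`
are switching equivalent. -/
theorem switchingEquivalentTo_of_isTransitiveK4 {T : MixedGraph W} {z : ZMod 6}
    (hT : IsSixthGain.IsTransitiveK4 T.N z) {F : MixedGraph (Fin 4)} (hF : F.graph = ⊤)
    (hz : ∀ i j, 0 < i → i < j → F.N 0 i * F.N i j * F.N j 0 = sixthRoot z) :
    T.SwitchingEquivalentTo F := by
  obtain ⟨s, hs, hsz⟩ := hT
  have hF0 : ∀ i j : Fin 4, i ≠ j → F.N i j ≠ 0 := fun i j hij => by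
    rw [ne_eq, N_eq_zero, not_not, hF]
    exact hij
  -- The scaling that makes the entries at vertex 0 agree; equal gains of the triangles at 0 then
  -- force the remaining entries to agree.
  let g : Fin 4 → ℂ := fun j => if j = 0 then 1 else F.N 0 j / T.N (s 0) (s j)
  have hg : ∀ j, g j ^ 6 = 1 := fun j => by
    by_cases hj : j = 0
    · simp [g, hj]
    · simp only [g, hj, if_false, div_pow]
      rw [(F.N_pow_six 0 j).resolve_left (hF0 _ _ (Ne.symm hj)),
        (T.N_pow_six _ _).resolve_left (hs _ _ (Ne.symm hj)), div_one]
  have hlt : ∀ i j, i < j → F.N i j = (g i)⁻¹ * T.N (s i) (s j) * g j := fun i j hij => by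
    have hj : j ≠ 0 := (i.zero_le.trans_lt hij).ne'
    have hTj := hs _ _ hj.symm
    by_cases hi : i = 0
    · simp only [g, hi, hj, if_true, if_false]
      field_simp
    · have hTi := hs _ _ (Ne.symm hi)
      have hFi := hF0 _ _ (Ne.symm hi)
      have hFj := hF0 _ _ hj.symm
      have key := (hsz i j (Fin.pos_of_ne_zero hi) hij).trans
        (hz i j (Fin.pos_of_ne_zero hi) hij).symm
      rw [← T.star_N (s 0) (s j), ← F.star_N 0 j,
        ← inv_eq_star_of_pow_six ((T.N_pow_six _ _).resolve_left hTj),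
        ← inv_eq_star_of_pow_six ((F.N_pow_six _ _).resolve_left hFj)] at key
      simp only [g, hi, hj, if_false]
      field_simp at key ⊢
      linear_combination -key
  have hall : ∀ i j, F.N i j = (g i)⁻¹ * T.N (s i) (s j) * g j := fun i j => by
    rcases lt_trichotomy i j with h | rfl | h
    · exact hlt i j h
    · simp [N_self]
    · have := congrArg star (hlt j i h)
      rw [star_N, star_mul, star_mul, star_N, ← inv_eq_star_of_pow_six (hg i),
        inv_eq_star_of_pow_six (hg j), star_star] at this
      rw [this]
      ring
  let M' : MixedGraph W :=
    { graph := F.graph.comap s.symm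
      Arc u v := F.Arc (s.symm u) (s.symm v)
      adj_of_arc h := F.adj_of_arc h
      arc_asymm h := F.arc_asymm h }
  refine ⟨M', Relation.ReflTransGen.single (Or.inl
    (isThreeWaySwitching_of_N_eq (f := fun u => g (s.symm u)) (fun u => hg _) fun u v => ?_)),
    s.symm, fun _ _ => Iff.rfl, fun _ _ => Iff.rfl⟩
  have := hall (s.symm u) (s.symm v)
  rw [s.apply_symm_apply, s.apply_symm_apply] at this
  exact this

theorem rank_eq_three_iff [Fintype V] (M : MixedGraph V) (hM : M.Connected)
    (S : Set V) (hS : M.IsTwinTransversal S) :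
    M.rank = 3 ↔
      (M.induce S).IsMixedTriangle ∨
        (M.induce S).SwitchingEquivalentTo mixedK4e ∨
        (M.induce S).SwitchingEquivalentTo mixedK4f := by
  have := Fintype.ofFinite S
  rw [← hS.rank_induce]
  refine ⟨fun hr => ?_, ?_⟩
  swap
  · rintro (h | h | h)
    · exact h.rank_eq
    · exact h.rank_eq.trans rank_mixedK4e
    · exact h.rank_eq.trans rank_mixedK4f
  obtain ⟨t, k, hk, -, hcol⟩ := hS.exists_N_eq
  have hrow : ∀ i : S, ∃ j, (M.induce S).N i j ≠ 0 := by
    have : Nontrivial V := by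
      rw [← Fintype.one_lt_card_iff_nontrivial]
      have := M.N.rank_le_card_width
      rw [hS.rank_induce, rank] at hr
      omega
    intro i
    obtain ⟨v, hv⟩ := hM.preconnected.exists_adj_of_nontrivial (i : V)
    -- The neighbour `v` may lie outside `S`, but its representative `t v` is then a neighbour too.
    refine ⟨t v, fun h => M.N_eq_zero.not_left.mpr hv ?_⟩
    rw [hcol]
    exact mul_eq_zero_of_right _ h
  have hred : ∀ (i j : S) (c : ℂ), c ^ 6 = 1 →
      (∀ l, (M.induce S).N i l = c * (M.induce S).N j l) → i = j := by
    intro i j c hc h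
    -- Every column is a multiple of one indexed by `S`, so proportionality within `S` gives twins
    -- in the whole graph.
    refine Subtype.ext (hS.2 i i.2 j j.2 (twins_of_N_eq hc fun v => ?_))
    have : M.N i (t v) = c * M.N j (t v) := h (t v)
    rw [hcol, hcol j, this]
    ring
  rcases (M.induce S).isSixthGain_N.classification hr hrow hred with ⟨s, hs⟩ | h | h
  · refine Or.inl ⟨⟨s.symm, fun {u v} => ?_⟩⟩
    rw [SimpleGraph.top_adj]
    refine ⟨fun h => ?_, fun h h' => h.ne (s.symm.injective h')⟩
    have := hs _ _ h
    rwa [s.apply_symm_apply, s.apply_symm_apply, ne_eq, N_eq_zero, not_not] at this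
  · refine Or.inr (Or.inl (switchingEquivalentTo_of_isTransitiveK4 h rfl fun i j hi hij => ?_))
    rw [mixedK4e_N, sixthRoot_one]
    fin_cases i <;> fin_cases j <;> simp at hi hij ⊢
  · refine Or.inr (Or.inr (switchingEquivalentTo_of_isTransitiveK4 h rfl fun i j hi hij => ?_))
    have h2 : sixthRoot 2 = omega * omega := by
      rw [show (2 : ZMod 6) = 1 + 1 by rfl, sixthRoot_add, sixthRoot_one]
    rw [mixedK4f_N, h2]
    fin_cases i <;> fin_cases j <;> simp at hi hij ⊢

end MixedGraph

theorem mainTheorem5 {V : Type*} [Fintype V] (M : MixedGraph V) (hM : M.Connected)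
    (S : Set V) (hS : M.IsTwinTransversal S) :
    M.rank = 3 ↔
      (M.induce S).IsMixedTriangle ∨
        (M.induce S).SwitchingEquivalentTo MixedGraph.mixedK4e ∨
        (M.induce S).SwitchingEquivalentTo MixedGraph.mixedK4f :=
  MixedGraph.rank_eq_three_iff M hM S hS
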